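/- **Setting.** Let $\Theta\subset\mathbb R^p$ be a bounded, convex, open set, let $\{\mathcal X_n,\mathcal A_n,(P_{n,\theta})_{\theta\in\Theta}\}_{n\in\mathbb N}$ be statistical experiments, fix $\theta_0\in\Theta$, and write $P_0=P_{n,\theta_0}$ and $E_0$ for the expectation under $P_0$. Let $\mathbb G_n:\mathcal X_n\times\overline\Theta\to\mathbb R^p$ be random functions, i.e. $\mathbb G_n(\theta)$ is measurable for each $\theta\in\Theta$, and let $(T_n)$ be a nonrandom sequence of positive reals with $T_n\to\infty$. Put $$\mathbb M_n(\theta)=-\frac1{T_n}|\mathbb G_n(\theta)|^2,\qquad \mathbb Z_n(u)=\exp\{\mathbb M_n(\theta_0+T_n^{-1/2}u)-\mathbb M_n(\theta_0)\}$$ for $u\in U_n:=\{u\in\mathbb R^p:\theta_0+T_n^{-1/2}u\in\Theta\}$. Let $\hat\theta_n$ be any measurable map with $P_0$-a.s. $\hat\theta_n\in\operatorname{argmax}_{\theta\in\overline\Theta}\mathbb M_n(\theta)$, and put $\hat u_n=\sqrt{T_n}(\hat\theta_n-\theta_0)$. **Assumptions.** Let $M>0$. 1. (Smoothness) $P_0$-a.s.,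 $\theta\mapsto\mathbb G_n(\theta)$ is continuous on $\overline\Theta$ and belongs to $\mathcal C^3(\Theta)$. 2. (Bounded moments) For every $K>0$, $$\sup_nE_0\Bigl[\bigl|T_n^{-1/2}\mathbb G_n(\theta_0)\bigr|^K\Bigr]+\max_{k\in\{0,1,2,3\}}\sup_nE_0\Bigl[\sup_{\theta\in\Theta}\bigl|T_n^{-1}\partial_\theta^k\mathbb G_n(\theta)\bigr|^K\Bigr]<\infty.$$ 3. (Limits) (a) There are a nonrandom function $\mathbb G_\infty:\Theta\to\mathbb R^p$ and constants $\chi,\varepsilon>0$ such that $\mathbb G_\infty(\theta_0)=0$, $\sup_{\theta\in\Theta}|\mathbb G_\infty(\theta)|<\infty$, $|\mathbb G_\infty(\theta)|^2\ge\chi|\theta-\theta_0|^2$ for every $\theta\in\Theta$, and $$\sup_nE_0\Bigl[\sup_{\theta\in\Theta}\bigl|\sqrt{T_n}\bigl(T_n^{-1}\mathbb G_n(\theta)-\mathbb G_\infty(\theta)\bigr)\bigr|^{M+\varepsilon}\Bigr]<\infty.$$ (b) There is a nonrandom $p\times p$ matrix $\mathbb G'_\infty$ of rank $p$ such that $$\sup_nE_0\Bigl[\bigl|\sqrt{T_n}\bigl(T_n^{-1}\partial_\theta\mathbb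 G_n(\theta_0)-\mathbb G'_\infty\bigr)\bigr|^{M}\Bigr]<\infty.$$ 4. (Weak convergence) $T_n^{-1/2}\mathbb G_n(\theta_0)$ converges in law under $P_0$ to $N_p(0,\mathbb V)$ for some positive definite $\mathbb V$. **Theorem.** (a) Under Assumptions 1–3, the polynomial type large deviation inequality of order $M$ holds: $$\sup_{r>0}\Bigl\{r^M\sup_{n\in\mathbb N}P_0\Bigl[\sup_{u\in U_n,\,|u|>r}\mathbb Z_n(u)\ge e^{-r}\Bigr]\Bigr\}<\infty,$$ where a supremum over the empty set is $0$. (b) If in addition Assumption 4 holds, then, with $\Sigma=(\mathbb G'_\infty)^{-1}\mathbb V\,((\mathbb G'_\infty)^{-1})^{\top}$, $$E_0[f(\hat u_n)]\to\int_{\mathbb R^p}f\,dN_p(0,\Sigma)\qquad(n\to\infty)$$ for every continuous $f:\mathbb R^p\to\mathbb R$ with $\limsup_{|u|\to\infty}|u|^{-q}|f(u)|<\infty$ for some $q\in(0,M)$; all these expectations and the integral on the right are finite. -/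

import Mathlib

open MeasureTheory ProbabilityTheory Filter Topology
open scoped ENNReal

noncomputable section

namespace EstimatingFunction

/-- `ℝ^p` with its Euclidean norm. -/
abbrev Vec (p : ℕ) := EuclideanSpace ℝ (Fin p)

/-- The contrast `M_n(θ) = - |G_n(θ)|² / T_n`. -/
def contrast {p : ℕ} {X : ℕ → Type*} (T : ℕ → ℝ) (G : ∀ n, X n → Vec p → Vec p)
    (n : ℕ) (x : X n) (θ : Vec p) : ℝ :=
  -(1 / T n) * ‖G n x θ‖ ^ 2

/-- The local parameter set `U_n(θ₀) = {u : θ₀ + T_n^{-1/2} u ∈ Θ}`. -/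
def localSet {p : ℕ} (Θ : Set (Vec p)) (θ₀ : Vec p) (T : ℕ → ℝ) (n : ℕ) : Set (Vec p) :=
  {u | θ₀ + (Real.sqrt (T n))⁻¹ • u ∈ Θ}

/-- The random field `Z_n(u) = exp {M_n(θ₀ + T_n^{-1/2} u) - M_n(θ₀)}`
(of interest for `u ∈ U_n(θ₀)`). -/
def randomField {p : ℕ} {X : ℕ → Type*} (T : ℕ → ℝ) (G : ∀ n, X n → Vec p → Vec p)
    (θ₀ : Vec p) (n : ℕ) (x : X n) (u : Vec p) : ℝ :=
  Real.exp (contrast T G n x (θ₀ + (Real.sqrt (T n))⁻¹ • u) - contrast T G n x θ₀)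

/-- Polynomial type large deviation inequality of order `M`:
`sup_{r > 0} r^M sup_n P_n [ sup_{u ∈ U_n(θ₀), |u| > r} Z_n(u) ≥ e^{-r} ] < ∞`.
The inner supremum is taken in `[0, ∞]`; it is `0` if no such `u` exists. -/
def PLDI {p : ℕ} {X : ℕ → Type*} [∀ n, MeasurableSpace (X n)] (P : ∀ n, Measure (X n))
    (T : ℕ → ℝ) (G : ∀ n, X n → Vec p → Vec p) (Θ : Set (Vec p)) (θ₀ : Vec p) (M : ℝ) : Prop :=
  (⨆ r : Set.Ioi (0 : ℝ), ENNReal.ofReal ((r : ℝ) ^ M) *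
    ⨆ n, P n {x | ENNReal.ofReal (Real.exp (-(r : ℝ))) ≤
      ⨆ u ∈ {u | u ∈ localSet Θ θ₀ T n ∧ (r : ℝ) < ‖u‖},
        ENNReal.ofReal (randomField T G θ₀ n x u)}) < ∞

/-- Smoothness: almost surely, `G_n` is continuous on the closure of `Θ` (its values on the
boundary are those of the continuous extension) and of class `C³` on `Θ`. -/
def Smoothness {p : ℕ} {X : ℕ → Type*} [∀ n, MeasurableSpace (X n)] (P : ∀ n, Measure (X n))
    (G : ∀ n, X n → Vec p → Vec p) (Θ : Set (Vec p)) : Prop :=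
  ∀ n, ∀ᵐ x ∂(P n), ContinuousOn (G n x) (closure Θ) ∧ ContDiffOn ℝ 3 (G n x) Θ

/-- Bounded moments: for every `K > 0`,
`sup_n E |T_n^{-1/2} G_n(θ₀)|^K + max_{k ≤ 3} sup_n E sup_{θ ∈ Θ} |T_n^{-1} ∂^k G_n(θ)|^K < ∞`. -/
def BoundedMoments {p : ℕ} {X : ℕ → Type*} [∀ n, MeasurableSpace (X n)]
    (P : ∀ n, Measure (X n)) (T : ℕ → ℝ) (G : ∀ n, X n → Vec p → Vec p)
    (Θ : Set (Vec p)) (θ₀ : Vec p) : Prop :=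
  ∀ K : ℝ, 0 < K →
    (⨆ n, ∫⁻ x, ‖(Real.sqrt (T n))⁻¹ • G n x θ₀‖ₑ ^ K ∂(P n)) +
      (⨆ k : Fin 4, ⨆ n, ∫⁻ x,
        (⨆ θ ∈ Θ, ‖(T n)⁻¹ • iteratedFDeriv ℝ (k : ℕ) (G n x) θ‖ₑ) ^ K ∂(P n)) < ∞

/-- Limits, part (a): the limit `Ginf` of `T_n^{-1} G_n` vanishes at `θ₀`, is bounded,
separates `θ₀` from the other parameters, and is approached at rate `T_n^{1/2}`,
uniformly on `Θ`, in a moment of order larger than `M`. -/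
structure LimitField {p : ℕ} {X : ℕ → Type*} [∀ n, MeasurableSpace (X n)]
    (P : ∀ n, Measure (X n)) (T : ℕ → ℝ) (G : ∀ n, X n → Vec p → Vec p)
    (Θ : Set (Vec p)) (θ₀ : Vec p) (M : ℝ) (Ginf : Vec p → Vec p) : Prop where
  zero : Ginf θ₀ = 0
  bounded : ∃ C : ℝ, ∀ θ ∈ Θ, ‖Ginf θ‖ ≤ C
  identifiable : ∃ χ : ℝ, 0 < χ ∧ ∀ θ ∈ Θ, χ * ‖θ - θ₀‖ ^ 2 ≤ ‖Ginf θ‖ ^ 2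
  moment : ∃ ε : ℝ, 0 < ε ∧
    (⨆ n, ∫⁻ x, (⨆ θ ∈ Θ, ‖Real.sqrt (T n) • ((T n)⁻¹ • G n x θ - Ginf θ)‖ₑ) ^ (M + ε)
      ∂(P n)) < ∞

/-- Limits, part (b): the limit `G'` of the Jacobian `T_n^{-1} ∂G_n(θ₀)` has rank `p` and is
approached at rate `T_n^{1/2}` in the moment of order `M`. -/
structure LimitJacobian {p : ℕ} {X : ℕ → Type*} [∀ n, MeasurableSpace (X n)]
    (P : ∀ n, Measure (X n)) (T : ℕ → ℝ) (G : ∀ n, X n → Vec p → Vec p)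
    (θ₀ : Vec p) (M : ℝ) (G' : Matrix (Fin p) (Fin p) ℝ) : Prop where
  rank : G'.rank = p
  moment : (⨆ n, ∫⁻ x, ‖Real.sqrt (T n) • ((T n)⁻¹ • fderiv ℝ (G n x) θ₀ -
      Matrix.toEuclideanCLM (𝕜 := ℝ) G')‖ₑ ^ M ∂(P n)) < ∞

/-- Weak convergence: `V` is positive definite and `T_n^{-1/2} G_n(θ₀)` converges in law to
`N_p(0, V)`. -/
def WeakConvergence {p : ℕ} {X : ℕ → Type*} [∀ n, MeasurableSpace (X n)]
    (P : ∀ n, Measure (X n)) [∀ n, IsProbabilityMeasure (P n)] (T : ℕ → ℝ)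
    (G : ∀ n, X n → Vec p → Vec p) (θ₀ : Vec p) (V : Matrix (Fin p) (Fin p) ℝ) : Prop :=
  V.PosDef ∧
    TendstoInDistribution (fun n x => (Real.sqrt (T n))⁻¹ • G n x θ₀) atTop
      (id : Vec p → Vec p) P (multivariateGaussian 0 V)

/-- The asymptotic covariance `Σ = (G')⁻¹ V (G')⁻ᵀ`. -/
def asympCov {p : ℕ} (G' V : Matrix (Fin p) (Fin p) ℝ) : Matrix (Fin p) (Fin p) ℝ :=
  G'⁻¹ * V * (G'⁻¹).transpose

/-- `θhat n` is a measurable maximizer of the contrast over the closure of `Θ`. As the contrast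
is only almost surely continuous, the maximization is asked for almost surely. -/
structure IsMEstimator {p : ℕ} {X : ℕ → Type*} [∀ n, MeasurableSpace (X n)]
    (P : ∀ n, Measure (X n)) (T : ℕ → ℝ) (G : ∀ n, X n → Vec p → Vec p)
    (Θ : Set (Vec p)) (θhat : ∀ n, X n → Vec p) : Prop where
  measurable : ∀ n, Measurable (θhat n)
  argmax : ∀ n, ∀ᵐ x ∂(P n), θhat n x ∈ closure Θ ∧
    ∀ θ ∈ closure Θ, contrast T G n x θ ≤ contrast T G n x (θhat n x)

/-- The normalized estimator `û_n = T_n^{1/2} (θhat_n - θ₀)`. -/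
def normalized {p : ℕ} {X : ℕ → Type*} (T : ℕ → ℝ) (θ₀ : Vec p) (θhat : ∀ n, X n → Vec p)
    (n : ℕ) (x : X n) : Vec p :=
  Real.sqrt (T n) • (θhat n x - θ₀)

end EstimatingFunction

end

/-!
The proof rests on one random variable: the maximal deviation `A_n` of `T_n^{-1} G_n` from its limit
`Ginf`, scaled by `T_n^{1/2}`. Since `|Ginf θ| ≥ c |θ - θ₀|`, the rescaled estimating function
satisfies `|T_n^{-1/2} G_n(θ)| ≥ c |u| - A_n` at the local parameter `u = T_n^{1/2} (θ - θ₀)`, and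
`|T_n^{-1/2} G_n(θ₀)| ≤ A_n` (`mul_norm_le_norm_add_maxDeviation`, `norm_le_maxDeviation`). This
gives two things.

* For `|u| > r` and `A_n < c r / 4` it gives `Z_n(u) ≤ exp(-c² r² / 2)`, which is below `exp(-r)`
  once `r > 2 / c²`. Markov's inequality for the `M`-th moment of `A_n` then yields the polynomial
  type large deviation inequality (`pldi_of_limitField`).
* A maximizer of the contrast satisfies `|G_n(θhat_n)| ≤ |G_n(θ₀)|`, so `|û_n| ≤ (2 / c) A_n`: the
  normalized estimators are bounded in `L^M` (`iSup_lintegral_normalized_lt_top`).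

For the limit law, a Taylor expansion shows that `T_n^{-1/2} G_n(θ)` equals
`T_n^{-1/2} G_n(θ₀) + G' u` up to an error of order `T_n^{-1/2}`, uniformly for bounded `u`. At the
point where this affine function vanishes, `G_n` is small, and by maximality it is even smaller at
`θhat_n`; hence `û_n + (G')⁻¹ T_n^{-1/2} G_n(θ₀) → 0` in probability
(`tendsto_measure_normalized_sub`), and Slutsky's lemma gives the Gaussian limit. Boundedness in
`L^M` makes `f(û_n)` uniformly integrable when `f` grows with order `q < M`, so that the
expectations converge as well (`tendsto_integral_of_tendstoInDistribution`).

The suprema over `Θ` in the hypotheses need not be measurable, and the lower integral of a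
nonmeasurable function does not control its tails. They are replaced by suprema over a countable
dense subset `D` of `Θ`, and the estimates obtained on `D` are extended to the closure of `Θ` by
continuity of `G_n`; no regularity of `Ginf` is needed for this.
-/

namespace EstimatingFunction

/-! ### Tail bounds from moments -/

section Tail

variable {X : ℕ → Type*} [∀ n, MeasurableSpace (X n)] {P : ∀ n, Measure (X n)}

/-- Markov's inequality for the `K`-th moment, uniformly in a family of measures. -/
lemma iSup_measure_le_of_iSup_lintegral_rpow {Y : ∀ n, X n → ℝ≥0∞}
    (hY : ∀ n, AEMeasurable (Y n) (P n)) {K : ℝ} (hK : 0 < K) {R : ℝ} (hR : 0 < R) :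
    ⨆ n, P n {x | ENNReal.ofReal R ≤ Y n x} ≤
      (⨆ n, ∫⁻ x, Y n x ^ K ∂(P n)) * ENNReal.ofReal (R ^ (-K)) := by
  refine iSup_le fun n => ?_
  have h0 : ENNReal.ofReal (R ^ K) ≠ 0 := by
    simpa using Real.rpow_pos_of_pos hR K
  have hset : {x | ENNReal.ofReal R ≤ Y n x} = {x | ENNReal.ofReal (R ^ K) ≤ Y n x ^ K} := by
    ext x
    simp only [Set.mem_ofPred_eq]
    rw [← ENNReal.ofReal_rpow_of_pos hR, ENNReal.rpow_le_rpow_iff hK]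
  rw [hset]
  refine (meas_ge_le_lintegral_div ((hY n).pow_const K) h0 ENNReal.ofReal_ne_top).trans ?_
  rw [div_eq_mul_inv, ← ENNReal.ofReal_inv_of_pos (Real.rpow_pos_of_pos hR K),
    ← Real.rpow_neg hR.le]
  gcongr
  exact le_iSup (fun n => ∫⁻ x, Y n x ^ K ∂(P n)) n

/-- A family with a bounded moment is bounded in probability. -/
lemma tendsto_iSup_measure_of_iSup_lintegral_rpow {Y : ∀ n, X n → ℝ≥0∞}
    (hY : ∀ n, AEMeasurable (Y n) (P n)) {K : ℝ} (hK : 0 < K)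
    (hmom : ⨆ n, ∫⁻ x, Y n x ^ K ∂(P n) < ∞) :
    Tendsto (fun R : ℝ => ⨆ n, P n {x | ENNReal.ofReal R ≤ Y n x}) atTop (𝓝 0) := by
  have h1 : Tendsto (fun R : ℝ => (⨆ n, ∫⁻ x, Y n x ^ K ∂(P n)) * ENNReal.ofReal (R ^ (-K)))
      atTop (𝓝 0) := by
    have := ENNReal.Tendsto.const_mul
      (ENNReal.tendsto_ofReal (tendsto_rpow_neg_atTop hK)) (Or.inr hmom.ne)
    simpa using this
  refine tendsto_of_tendsto_of_tendsto_of_le_of_le' tendsto_const_nhds h1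
    (Eventually.of_forall fun _ => zero_le) ?_
  filter_upwards [eventually_gt_atTop 0] with R hR
  exact iSup_measure_le_of_iSup_lintegral_rpow hY hK hR

/-- On probability spaces, boundedness of a moment implies boundedness of the lower ones. -/
lemma iSup_lintegral_rpow_lt_top_of_le [∀ n, IsProbabilityMeasure (P n)] {Y : ∀ n, X n → ℝ≥0∞}
    {K L : ℝ} (hK : 0 ≤ K) (hKL : K ≤ L) (h : ⨆ n, ∫⁻ x, Y n x ^ L ∂(P n) < ∞) :
    ⨆ n, ∫⁻ x, Y n x ^ K ∂(P n) < ∞ := by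
  refine lt_of_le_of_lt (b := 1 + ⨆ n, ∫⁻ x, Y n x ^ L ∂(P n)) (iSup_le fun n => ?_) (by simp [h])
  calc ∫⁻ x, Y n x ^ K ∂(P n) ≤ ∫⁻ x, (1 + Y n x ^ L) ∂(P n) := by
        refine lintegral_mono fun x => ?_
        rcases le_total (Y n x) 1 with hx | hx
        · exact (ENNReal.rpow_le_one hx hK).trans le_self_add
        · exact (ENNReal.rpow_le_rpow_of_exponent_le hx hKL).trans le_add_self
    _ = 1 + ∫⁻ x, Y n x ^ L ∂(P n) := by
        rw [lintegral_add_left measurable_const]; simp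
    _ ≤ _ := by
        gcongr
        exact le_iSup (fun n => ∫⁻ x, Y n x ^ L ∂(P n)) n

end Tail

/-! ### Convergence in distribution on varying probability spaces -/

section Distribution

variable {X : ℕ → Type*} [∀ n, MeasurableSpace (X n)] {P : ∀ n, Measure (X n)}
  [∀ n, IsProbabilityMeasure (P n)]
  {Ω : Type*} [MeasurableSpace Ω] {μ : Measure Ω} [IsProbabilityMeasure μ]

/-- Slutsky's lemma for random vectors defined on different probability spaces. It is reduced to
the case of a single space by lifting all of them to the product space `∏ n, X n`. -/
lemma tendstoInDistribution_of_tendsto_measure_sub {E : Type*} [NormedAddCommGroup E]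
    [SecondCountableTopology E] [MeasurableSpace E] [BorelSpace E]
    {Y W : ∀ n, X n → E} {Z : Ω → E}
    (hY : TendstoInDistribution Y atTop Z P μ) (hW : ∀ n, AEMeasurable (W n) (P n))
    (h : ∀ δ : ℝ, 0 < δ → Tendsto (fun n => P n {x | δ ≤ ‖W n x - Y n x‖}) atTop (𝓝 0)) :
    TendstoInDistribution W atTop Z P μ := by
  have hev n := measurePreserving_eval_infinitePi P n
  have hYm n := hY.forall_aemeasurable n
  have hYm' n : AEMeasurable (fun ω : ∀ n, X n => Y n (ω n)) (Measure.infinitePi P) :=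
    (hYm n).comp_quasiMeasurePreserving (hev n).quasiMeasurePreserving
  have hWm' n : AEMeasurable (fun ω : ∀ n, X n => W n (ω n)) (Measure.infinitePi P) :=
    (hW n).comp_quasiMeasurePreserving (hev n).quasiMeasurePreserving
  have hmap {V : ∀ n, X n → E} (hV : ∀ n, AEMeasurable (V n) (P n)) n :
      (Measure.infinitePi P).map (fun ω => V n (ω n)) = (P n).map (V n) := by
    have := (hev n).map_eq
    conv_rhs => rw [← this]
    rw [AEMeasurable.map_map_of_aemeasurable (by rw [this]; exact hV n)
      (hev n).measurable.aemeasurable]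
    rfl
  have hY' : TendstoInDistribution (fun n (ω : ∀ n, X n) => Y n (ω n)) atTop Z
      (fun _ => Measure.infinitePi P) μ := by
    exact ⟨hYm', hY.aemeasurable_limit,
      hY.tendsto.congr fun n => Subtype.ext (hmap hYm n).symm⟩
  have hW' := tendstoInDistribution_of_tendstoInMeasure_sub
    (fun n (ω : ∀ n, X n) => W n (ω n)) Z hY' (by
      rw [tendstoInMeasure_iff_norm]
      intro δ hδ
      refine (h δ hδ).congr fun n => ?_
      have hn : NullMeasurableSet {x | δ ≤ ‖W n x - Y n x‖} (P n) :=
        nullMeasurableSet_le aemeasurable_const ((hW n).sub (hYm n)).norm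
      rw [← (hev n).measure_preimage hn]
      simp) hWm'
  exact ⟨hW, hY.aemeasurable_limit, hW'.tendsto.congr fun n => Subtype.ext (hmap hW n)⟩

/-- Truncation of a real number to `[-K, K]`. -/
def truncate (K : ℝ) (w : ℝ) : ℝ := max (-K) (min w K)

lemma continuous_truncate (K : ℝ) : Continuous (truncate K) := by
  unfold truncate; fun_prop

lemma abs_truncate_le {K : ℝ} (hK : 0 ≤ K) (w : ℝ) : |truncate K w| ≤ K := by
  unfold truncate
  rw [abs_le]
  exact ⟨le_max_left _ _, max_le (by linarith) (min_le_right _ _)⟩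

lemma truncate_of_abs_le {K w : ℝ} (h : |w| ≤ K) : truncate K w = w := by
  rw [abs_le] at h
  unfold truncate
  rw [min_eq_left h.2, max_eq_right h.1]

lemma abs_truncate_le_abs {K : ℝ} (hK : 0 ≤ K) (w : ℝ) : |truncate K w| ≤ |w| := by
  rcases le_total |w| K with h | h
  · rw [truncate_of_abs_le h]
  · exact (abs_truncate_le hK w).trans h

lemma abs_sub_truncate_le_abs {K : ℝ} (hK : 0 ≤ K) (w : ℝ) : |w - truncate K w| ≤ |w| := by
  unfold truncate
  rcases max_cases (-K) (min w K) with h | h <;> rcases min_cases w K with h' | h' <;>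
  rcases abs_cases w with h'' | h'' <;> rw [abs_le] <;> constructor <;> linarith

/-- The truncation error at level `K` is at most `|w|^s K^{1-s}`. -/
lemma abs_sub_truncate_le {K s : ℝ} (hK : 0 < K) (hs : 1 < s) (w : ℝ) :
    |w - truncate K w| ≤ K ^ (1 - s) * |w| ^ s := by
  rcases le_or_gt |w| K with h | h
  · rw [truncate_of_abs_le h]; simp; positivity
  · have hw : 0 < |w| := hK.trans h
    calc |w - truncate K w| ≤ |w| := abs_sub_truncate_le_abs hK.le w
      _ = |w| ^ (1 - s) * |w| ^ s := by rw [← Real.rpow_add hw]; simp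
      _ ≤ K ^ (1 - s) * |w| ^ s := by
        gcongr ?_ * _
        exact Real.rpow_le_rpow_of_nonpos hK h.le (by linarith)

/-- Convergence in distribution together with boundedness of a moment of order `s > 1` gives
convergence of the expectations. -/
lemma tendsto_integral_of_tendstoInDistribution {Y : ∀ n, X n → ℝ} {Z : Ω → ℝ}
    (hY : TendstoInDistribution Y atTop Z P μ) (hZ : Integrable Z μ) {s : ℝ} (hs : 1 < s)
    (hmom : ⨆ n, ∫⁻ x, ‖Y n x‖ₑ ^ s ∂(P n) < ∞) :
    (∀ n, Integrable (Y n) (P n)) ∧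
      Tendsto (fun n => ∫ x, Y n x ∂(P n)) atTop (𝓝 (∫ ω, Z ω ∂μ)) := by
  set C := ⨆ n, ∫⁻ x, ‖Y n x‖ₑ ^ s ∂(P n) with hC
  have hs0 : 0 < s := by linarith
  have hYm n : AEStronglyMeasurable (Y n) (P n) := (hY.forall_aemeasurable n).aestronglyMeasurable
  have hint_s n : Integrable (fun x => |Y n x| ^ s) (P n) := by
    refine ⟨((hY.forall_aemeasurable n).abs.pow_const s).aestronglyMeasurable, ?_⟩
    refine lt_of_le_of_lt ?_ hmom
    refine le_trans (le_of_eq ?_) (le_iSup _ n)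
    refine lintegral_congr fun x => ?_
    rw [Real.enorm_rpow_of_nonneg (abs_nonneg _) hs0.le, Real.enorm_abs]
  have hint_le n : ∫ x, |Y n x| ^ s ∂(P n) ≤ C.toReal := by
    rw [integral_eq_lintegral_of_nonneg_ae (Eventually.of_forall fun x => by positivity)
      (hint_s n).aestronglyMeasurable]
    refine ENNReal.toReal_mono hmom.ne ?_
    refine le_trans (le_of_eq ?_) (le_iSup _ n)
    refine lintegral_congr fun x => ?_
    rw [← ENNReal.ofReal_rpow_of_nonneg (abs_nonneg _) hs0.le, Real.enorm_eq_ofReal_abs]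
  have hint n : Integrable (Y n) (P n) := by
    refine ((integrable_const (1 : ℝ)).add (hint_s n)).mono' (hYm n)
      (Eventually.of_forall fun x => ?_)
    simp only [Pi.add_apply, Real.norm_eq_abs]
    rcases le_total |Y n x| 1 with hx | hx
    · have : (0 : ℝ) ≤ |Y n x| ^ s := by positivity
      linarith
    · have := Real.rpow_le_rpow_of_exponent_le hx hs.le
      rw [Real.rpow_one] at this
      linarith
  have htrunc K n (hK : 0 < K) : Integrable (fun x => truncate K (Y n x)) (P n) :=
    Integrable.of_bound ((continuous_truncate K).comp_aestronglyMeasurable (hYm n)) K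
      (Eventually.of_forall fun x => abs_truncate_le hK.le _)
  refine ⟨hint, ?_⟩
  refine TendstoUniformlyOnFilter.tendsto_of_eventually_tendsto (p := atTop)
    (F := fun (K : ℝ) n => ∫ x, truncate K (Y n x) ∂(P n))
    (L := fun K : ℝ => ∫ ω, truncate K (Z ω) ∂μ) ?_ ?_ ?_
  · -- the truncation error is bounded by `K^{1-s} C`, uniformly in `n`
    rw [Metric.tendstoUniformlyOnFilter_iff]
    intro ε hε
    have hlim : Tendsto (fun K : ℝ => K ^ (1 - s) * C.toReal) atTop (𝓝 0) := by
      have := (tendsto_rpow_neg_atTop (y := s - 1) (by linarith)).mul_const C.toReal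
      simpa using this
    refine Eventually.prod_inl (p := fun K => ∀ n, dist (∫ x, Y n x ∂(P n))
      (∫ x, truncate K (Y n x) ∂(P n)) < ε) ?_ _ |>.mono fun q hq => hq q.2
    filter_upwards [hlim.eventually_lt_const hε, eventually_gt_atTop 0] with K hKε hK n
    refine lt_of_le_of_lt ?_ hKε
    rw [Real.dist_eq, ← integral_sub (hint n) (htrunc K n hK)]
    calc |∫ x, (Y n x - truncate K (Y n x)) ∂(P n)|
        ≤ ∫ x, |Y n x - truncate K (Y n x)| ∂(P n) := abs_integral_le_integral_abs
      _ ≤ ∫ x, K ^ (1 - s) * |Y n x| ^ s ∂(P n) :=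
          integral_mono ((hint n).sub (htrunc K n hK)).abs ((hint_s n).const_mul _)
            fun x => abs_sub_truncate_le hK hs _
      _ = K ^ (1 - s) * ∫ x, |Y n x| ^ s ∂(P n) := integral_const_mul _ _
      _ ≤ K ^ (1 - s) * C.toReal := by gcongr; exact hint_le n
  · filter_upwards [eventually_gt_atTop 0] with K hK
    have h := ProbabilityMeasure.tendsto_iff_forall_integral_tendsto.1 hY.tendsto
      (BoundedContinuousFunction.ofNormedAddCommGroup (truncate K)
      (continuous_truncate K) K fun w => abs_truncate_le hK.le w)
    simp only [ProbabilityMeasure.coe_mk, BoundedContinuousFunction.coe_ofNormedAddCommGroup] at h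
    rw [integral_map hY.aemeasurable_limit (continuous_truncate K).aestronglyMeasurable] at h
    refine h.congr fun n => ?_
    rw [integral_map (hY.forall_aemeasurable n) (continuous_truncate K).aestronglyMeasurable]
  · refine tendsto_integral_filter_of_dominated_convergence (fun ω => |Z ω|) ?_ ?_ hZ.abs ?_
    · exact Eventually.of_forall fun K =>
        (continuous_truncate K).comp_aestronglyMeasurable hZ.aestronglyMeasurable
    · filter_upwards [eventually_ge_atTop 0] with K hK
      exact Eventually.of_forall fun ω => abs_truncate_le_abs hK _
    · refine Eventually.of_forall fun ω => tendsto_const_nhds.congr' ?_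
      filter_upwards [eventually_ge_atTop |Z ω|] with K hK
      exact (truncate_of_abs_le hK).symm

end Distribution

/-! ### Linear images of Gaussian vectors -/

section Gaussian

variable {p : ℕ}

/-- The image of `N(0, V)` under the matrix `B` is `N(0, B V Bᵀ)`. -/
lemma map_multivariateGaussian_zero (B : Matrix (Fin p) (Fin p) ℝ) {V : Matrix (Fin p) (Fin p) ℝ}
    (hV : V.PosSemidef) :
    (multivariateGaussian 0 V).map (Matrix.toEuclideanCLM (𝕜 := ℝ) B) =
      multivariateGaussian 0 (B * V * B.transpose) := by
  have hBV : (B * V * B.transpose).PosSemidef := by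
    simpa using hV.mul_mul_conjTranspose_same B
  have : IsProbabilityMeasure
      ((multivariateGaussian 0 V).map (Matrix.toEuclideanCLM (𝕜 := ℝ) B)) :=
    Measure.isProbabilityMeasure_map (by fun_prop)
  refine Measure.ext_of_charFun ?_
  ext t
  have hadj : ∀ x : Vec p, inner ℝ (Matrix.toEuclideanCLM (𝕜 := ℝ) B x) t =
      inner ℝ x (Matrix.toEuclideanCLM (𝕜 := ℝ) B.transpose t) := by
    intro x
    rw [real_inner_comm, Matrix.inner_toEuclideanCLM, Matrix.inner_toEuclideanCLM,
      Matrix.dotProduct_mulVec, ← Matrix.mulVec_transpose, dotProduct_comm]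
  rw [charFun_apply, integral_map (by fun_prop) (by fun_prop)]
  simp_rw [hadj]
  rw [← charFun_apply, charFun_multivariateGaussian hV, charFun_multivariateGaussian hBV]
  congr 1
  simp only [inner_zero_right, Matrix.ofLp_toEuclideanCLM]
  congr 3
  rw [Matrix.mulVec_mulVec, Matrix.mul_assoc, ← Matrix.mulVec_mulVec _ B,
    Matrix.dotProduct_mulVec t.ofLp B, ← Matrix.mulVec_transpose]

/-- A Gaussian vector has moments of all orders. -/
lemma integrable_norm_rpow_multivariateGaussian (m : Vec p) (V : Matrix (Fin p) (Fin p) ℝ)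
    {K : ℝ} (hK : 0 < K) : Integrable (fun u => ‖u‖ ^ K) (multivariateGaussian m V) := by
  have h := (IsGaussian.memLp_id (multivariateGaussian m V) (ENNReal.ofReal K)
    ENNReal.ofReal_ne_top).integrable_norm_rpow (by simpa using hK) ENNReal.ofReal_ne_top
  simpa [ENNReal.toReal_ofReal hK.le] using h

end Gaussian

/-! ### Functions of polynomial growth -/

section Growth

/-- A continuous function whose growth at infinity is of order `q` is dominated by
`C max(1, |u|)^q` everywhere. -/
lemma exists_abs_le_max_one_norm_rpow {p : ℕ} {f : Vec p → ℝ} (hf : Continuous f) {q : ℝ}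
    (hlim : limsup (fun u => ENNReal.ofReal (‖u‖ ^ (-q) * |f u|))
      (Bornology.cobounded (Vec p)) < ∞) (hq : 0 < q) :
    ∃ C : ℝ, 0 ≤ C ∧ ∀ u, |f u| ≤ C * max 1 ‖u‖ ^ q := by
  obtain ⟨c, hc, hctop⟩ := exists_between hlim
  have hev := eventually_lt_of_limsup_lt hc
  rw [Metric.cobounded_eq_cocompact, Filter.eventually_iff, Filter.mem_cocompact] at hev
  obtain ⟨t, ht, htc⟩ := hev
  obtain ⟨B, hB⟩ := ht.exists_bound_of_continuousOn hf.continuousOn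
  refine ⟨max (max B c.toReal) |f 0|, le_max_of_le_right (abs_nonneg _), fun u => ?_⟩
  have hone : 1 ≤ max 1 ‖u‖ ^ q := Real.one_le_rpow (le_max_left _ _) hq.le
  have hC0 : 0 ≤ max (max B c.toReal) |f 0| := le_max_of_le_right (abs_nonneg _)
  by_cases hu : u ∈ t
  · calc |f u| ≤ B := hB u hu
      _ ≤ max (max B c.toReal) |f 0| := (le_max_left _ _).trans (le_max_left _ _)
      _ ≤ _ := le_mul_of_one_le_right hC0 hone
  rcases eq_or_ne u 0 with rfl | hu0
  · exact (le_max_right _ _).trans (le_mul_of_one_le_right hC0 hone)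
  have hnu : 0 < ‖u‖ := norm_pos_iff.2 hu0
  have h := htc hu
  simp only [Set.mem_ofPred_eq] at h
  have h' : ‖u‖ ^ (-q) * |f u| ≤ c.toReal :=
    (ENNReal.ofReal_le_iff_le_toReal hctop.ne).1 h.le
  rw [Real.rpow_neg hnu.le, inv_mul_le_iff₀ (by positivity)] at h'
  calc |f u| ≤ ‖u‖ ^ q * c.toReal := h'
    _ ≤ max 1 ‖u‖ ^ q * max (max B c.toReal) |f 0| := by
      gcongr
      · exact le_max_right _ _
      · exact (le_max_right _ _).trans (le_max_left _ _)
    _ = _ := mul_comm _ _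

end Growth

/-! ### Measurable majorants of the random suprema -/

section Suprema

variable {p : ℕ} {X : ℕ → Type*} {T : ℕ → ℝ} {G : ∀ n, X n → Vec p → Vec p}
  {Θ D : Set (Vec p)} {θ₀ : Vec p}

lemma exists_countable_subset_dense (hopen : IsOpen Θ) (hθ₀ : θ₀ ∈ Θ) :
    ∃ D ⊆ Θ, D.Countable ∧ θ₀ ∈ D ∧ closure Θ ⊆ closure D := by
  obtain ⟨S, hSc, hSd⟩ := TopologicalSpace.exists_countable_dense (Vec p)
  refine ⟨insert θ₀ (Θ ∩ S), Set.insert_subset hθ₀ Set.inter_subset_left,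
    (hSc.mono Set.inter_subset_right).insert _, Set.mem_insert _ _, ?_⟩
  refine closure_minimal ((hSd.open_subset_closure_inter hopen).trans ?_) isClosed_closure
  exact closure_mono (Set.subset_insert _ _)

/-- An inequality between continuous functions extends from a dense subset. -/
lemma le_on_closure_of_dense (hDΘ : D ⊆ Θ) (hD : closure Θ ⊆ closure D) {f k : Vec p → ℝ}
    (hf : ContinuousOn f (closure Θ)) (hk : ContinuousOn k (closure Θ))
    (h : ∀ θ ∈ D, f θ ≤ k θ) {θ : Vec p} (hθ : θ ∈ closure Θ) : f θ ≤ k θ := by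
  have hsub : D ⊆ closure Θ := hDΘ.trans subset_closure
  exact ContinuousWithinAt.closure_le (hD hθ) ((hf θ hθ).mono hsub) ((hk θ hθ).mono hsub) h

/-- The largest normalized deviation of `T_n^{-1} G_n` from its limit over `D`. In the applications
`D` is a countable dense subset of `Θ`, which makes it measurable. -/
noncomputable def maxDeviation (T : ℕ → ℝ) (G : ∀ n, X n → Vec p → Vec p) (Ginf : Vec p → Vec p)
    (D : Set (Vec p)) (n : ℕ) (x : X n) : ℝ≥0∞ :=
  ⨆ θ ∈ D, ‖Real.sqrt (T n) • ((T n)⁻¹ • G n x θ - Ginf θ)‖ₑ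

/-- The largest first-order Taylor remainder of `T_n^{-1} G_n` at `θ₀`, relative to `|θ - θ₀|²`,
over `D`. The term at `θ = θ₀` is `0`. -/
noncomputable def taylorRemainder (T : ℕ → ℝ) (G : ∀ n, X n → Vec p → Vec p) (θ₀ : Vec p)
    (D : Set (Vec p)) (n : ℕ) (x : X n) : ℝ≥0∞ :=
  ⨆ θ ∈ D, ‖(T n * ‖θ - θ₀‖ ^ 2)⁻¹ •
    (G n x θ - G n x θ₀ - fderiv ℝ (G n x) θ₀ (θ - θ₀))‖ₑ

/-- The normalized deviation of the Jacobian of `T_n^{-1} G_n` at `θ₀` from its limit. -/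
noncomputable def jacobianDeviation (T : ℕ → ℝ) (G : ∀ n, X n → Vec p → Vec p) (θ₀ : Vec p)
    (G' : Matrix (Fin p) (Fin p) ℝ) (n : ℕ) (x : X n) : ℝ≥0∞ :=
  ‖Real.sqrt (T n) • ((T n)⁻¹ • fderiv ℝ (G n x) θ₀ - Matrix.toEuclideanCLM (𝕜 := ℝ) G')‖ₑ

/-- Taylor's formula on the convex set `Θ` bounds the remainder by the second derivative. -/
lemma taylorRemainder_le (hT : ∀ n, 0 < T n) (hopen : IsOpen Θ) (hconvex : Convex ℝ Θ)
    (hθ₀ : θ₀ ∈ Θ) (hDΘ : D ⊆ Θ) {n : ℕ} {x : X n} (hx : ContDiffOn ℝ 3 (G n x) Θ) :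
    taylorRemainder T G θ₀ D n x ≤ ⨆ θ ∈ Θ, ‖(T n)⁻¹ • iteratedFDeriv ℝ 2 (G n x) θ‖ₑ := by
  set S := ⨆ θ ∈ Θ, ‖(T n)⁻¹ • iteratedFDeriv ℝ 2 (G n x) θ‖ₑ with hS
  rcases eq_or_ne S ∞ with hStop | hStop
  · rw [hStop]; exact le_top
  have hTn := hT n
  have hat : ∀ θ ∈ Θ, ContDiffAt ℝ 3 (G n x) θ := fun θ hθ => hx.contDiffAt (hopen.mem_nhds hθ)
  have hd : ∀ θ ∈ Θ, DifferentiableAt ℝ (G n x) θ := fun θ hθ =>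
    (hat θ hθ).differentiableAt (by norm_num)
  have hd2 : ∀ θ ∈ Θ, DifferentiableAt ℝ (fderiv ℝ (G n x)) θ := fun θ hθ =>
    ((hat θ hθ).fderiv_right (m := 1) (by norm_num)).differentiableAt (by norm_num)
  have hb2 : ∀ θ ∈ Θ, ‖fderiv ℝ (fderiv ℝ (G n x)) θ‖ ≤ T n * S.toReal := by
    intro θ hθ
    have h : ‖(T n)⁻¹ • iteratedFDeriv ℝ 2 (G n x) θ‖ₑ ≤ S :=
      le_iSup₂ (f := fun θ (_ : θ ∈ Θ) => ‖(T n)⁻¹ • iteratedFDeriv ℝ 2 (G n x) θ‖ₑ) θ hθ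
    have h' : ‖(T n)⁻¹ • iteratedFDeriv ℝ 2 (G n x) θ‖ ≤ S.toReal := by
      rw [← toReal_enorm]; exact ENNReal.toReal_mono hStop h
    rw [norm_smul, norm_inv, Real.norm_of_nonneg hTn.le, inv_mul_le_iff₀ hTn] at h'
    rwa [← norm_iteratedFDeriv_one (f := fderiv ℝ (G n x)), norm_iteratedFDeriv_fderiv]
  refine iSup₂_le fun θ hθD => ?_
  have hθ := hDΘ hθD
  have hseg : segment ℝ θ₀ θ ⊆ Θ := hconvex.segment_subset hθ₀ hθ
  have hK : 0 ≤ T n * S.toReal := by positivity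
  have hrem : ‖G n x θ - G n x θ₀ - fderiv ℝ (G n x) θ₀ (θ - θ₀)‖ ≤
      T n * S.toReal * ‖θ - θ₀‖ * ‖θ - θ₀‖ := by
    refine (convex_segment θ₀ θ).norm_image_sub_le_of_norm_fderiv_le'
      (fun y hy => hd y (hseg hy)) (fun y hy => ?_) (left_mem_segment ℝ θ₀ θ)
      (right_mem_segment ℝ θ₀ θ)
    refine (hconvex.norm_image_sub_le_of_norm_fderiv_le hd2 hb2 hθ₀ (hseg hy)).trans ?_
    gcongr
    simpa using norm_sub_le_of_mem_segment hy
  rw [← ofReal_norm, ENNReal.ofReal_le_iff_le_toReal hStop, norm_smul, norm_inv,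
    Real.norm_of_nonneg (by positivity)]
  rcases eq_or_ne θ θ₀ with rfl | hne
  · simp
  have hpos : 0 < ‖θ - θ₀‖ := norm_pos_iff.2 (sub_ne_zero.2 hne)
  rw [inv_mul_le_iff₀ (by positivity)]
  linarith [hrem]

variable [∀ n, MeasurableSpace (X n)]

lemma measurable_maxDeviation (hG : ∀ n, ∀ θ ∈ Θ, Measurable (fun x => G n x θ)) (hDΘ : D ⊆ Θ)
    (hDc : D.Countable) (Ginf : Vec p → Vec p) (n : ℕ) :
    Measurable (maxDeviation T G Ginf D n) := by
  refine Measurable.biSup _ hDc fun θ hθ => ?_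
  have := hG n θ (hDΘ hθ)
  fun_prop

lemma aemeasurable_fderiv_apply {Y : Type*} [MeasurableSpace Y] {μ : Measure Y}
    {F : Y → Vec p → Vec p} (hopen : IsOpen Θ) (hθ₀ : θ₀ ∈ Θ)
    (hF : ∀ θ ∈ Θ, Measurable (fun x => F x θ))
    (hdiff : ∀ᵐ x ∂μ, DifferentiableAt ℝ (F x) θ₀) (v : Vec p) :
    AEMeasurable (fun x => fderiv ℝ (F x) θ₀ v) μ := by
  have hlim : Tendsto (fun c : ℝ => θ₀ + c⁻¹ • v) atTop (𝓝 θ₀) := by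
    have : Tendsto (fun c : ℝ => θ₀ + c⁻¹ • v) atTop (𝓝 (θ₀ + (0 : ℝ) • v)) :=
      tendsto_const_nhds.add (tendsto_inv_atTop_zero.smul_const v)
    simpa using this
  obtain ⟨N, hN⟩ := eventually_atTop.1 (hlim.eventually_mem (hopen.mem_nhds hθ₀))
  -- difference quotients with steps so small that only points of `Θ` are visited
  refine aemeasurable_of_tendsto_metrizable_ae atTop
    (f := fun (k : ℕ) x => (N + k : ℝ) • (F x (θ₀ + (N + k : ℝ)⁻¹ • v) - F x θ₀)) ?_ ?_
  · intro k
    have h1 := hF _ (hN (N + k) (by simp))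
    have h2 := hF _ hθ₀
    exact ((h1.sub h2).const_smul (N + k : ℝ)).aemeasurable
  · filter_upwards [hdiff] with x hx
    exact (hx.hasFDerivAt.lim_real v).comp
      (tendsto_atTop_add_const_left _ N tendsto_natCast_atTop_atTop)

lemma aemeasurable_fderiv {Y : Type*} [MeasurableSpace Y] {μ : Measure Y}
    {F : Y → Vec p → Vec p} (hopen : IsOpen Θ) (hθ₀ : θ₀ ∈ Θ)
    (hF : ∀ θ ∈ Θ, Measurable (fun x => F x θ))
    (hdiff : ∀ᵐ x ∂μ, DifferentiableAt ℝ (F x) θ₀) :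
    AEMeasurable (fun x => fderiv ℝ (F x) θ₀) μ := by
  -- a linear map depends linearly, hence continuously, on its values at a basis
  let Φ : (Fin p → Vec p) →ₗ[ℝ] (Vec p →L[ℝ] Vec p) :=
    { toFun := fun w => ∑ i, (EuclideanSpace.proj i : Vec p →L[ℝ] ℝ).smulRight (w i)
      map_add' := fun w w' => by ext; simp [Finset.sum_add_distrib]
      map_smul' := fun c w => by ext; simp [Finset.mul_sum, mul_left_comm] }
  have hΦ : Continuous Φ := LinearMap.continuous_of_finiteDimensional Φ
  have heq : ∀ A : Vec p →L[ℝ] Vec p, Φ (fun i => A (EuclideanSpace.single i 1)) = A := by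
    intro A
    refine ContinuousLinearMap.coe_injective
      ((EuclideanSpace.basisFun (Fin p) ℝ).toBasis.ext fun i => ?_)
    simp [Φ]
  have h := hΦ.measurable.comp_aemeasurable (aemeasurable_pi_lambda
    (fun x i => fderiv ℝ (F x) θ₀ (EuclideanSpace.single i (1 : ℝ)))
    fun i => aemeasurable_fderiv_apply hopen hθ₀ hF hdiff _)
  exact h.congr (Eventually.of_forall fun x => heq _)

variable {P : ∀ n, Measure (X n)}

lemma Smoothness.ae_differentiableAt (h1 : Smoothness P G Θ) (hopen : IsOpen Θ) (hθ₀ : θ₀ ∈ Θ)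
    (n : ℕ) : ∀ᵐ x ∂(P n), DifferentiableAt ℝ (G n x) θ₀ := by
  filter_upwards [h1 n] with x hx
  exact (hx.2.contDiffAt (hopen.mem_nhds hθ₀)).differentiableAt (by norm_num)

lemma aemeasurable_jacobianDeviation (hopen : IsOpen Θ) (hθ₀ : θ₀ ∈ Θ)
    (hG : ∀ n, ∀ θ ∈ Θ, Measurable (fun x => G n x θ)) (h1 : Smoothness P G Θ)
    (G' : Matrix (Fin p) (Fin p) ℝ) (n : ℕ) :
    AEMeasurable (jacobianDeviation T G θ₀ G' n) (P n) := by
  have h := aemeasurable_fderiv hopen hθ₀ (hG n) (h1.ae_differentiableAt hopen hθ₀ n)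
  have h2 : AEMeasurable (fun x => Real.sqrt (T n) • ((T n)⁻¹ • fderiv ℝ (G n x) θ₀ -
      Matrix.toEuclideanCLM (𝕜 := ℝ) G')) (P n) :=
    ((h.const_smul (T n)⁻¹).sub_const (Matrix.toEuclideanCLM (𝕜 := ℝ) G')).const_smul
      (Real.sqrt (T n))
  exact h2.enorm

lemma aemeasurable_taylorRemainder (hopen : IsOpen Θ) (hθ₀ : θ₀ ∈ Θ)
    (hG : ∀ n, ∀ θ ∈ Θ, Measurable (fun x => G n x θ)) (h1 : Smoothness P G Θ)
    (hDΘ : D ⊆ Θ) (hDc : D.Countable) (n : ℕ) :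
    AEMeasurable (taylorRemainder T G θ₀ D n) (P n) := by
  refine AEMeasurable.biSup _ hDc fun θ hθ => ?_
  have h := aemeasurable_fderiv_apply hopen hθ₀ (hG n) (h1.ae_differentiableAt hopen hθ₀ n)
    (θ - θ₀)
  have h2 : AEMeasurable (fun x => G n x θ - G n x θ₀ - fderiv ℝ (G n x) θ₀ (θ - θ₀)) (P n) :=
    ((hG n θ (hDΘ hθ)).sub (hG n θ₀ hθ₀)).aemeasurable.sub h
  exact (h2.const_smul (T n * ‖θ - θ₀‖ ^ 2)⁻¹).enorm

end Suprema

/-! ### The deterministic estimates -/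

section Deterministic

variable {p : ℕ} {X : ℕ → Type*} {T : ℕ → ℝ} {G : ∀ n, X n → Vec p → Vec p}
  {Θ D : Set (Vec p)} {θ₀ : Vec p}

lemma contrast_eq (hT : ∀ n, 0 < T n) (n : ℕ) (x : X n) (θ : Vec p) :
    contrast T G n x θ = -‖(Real.sqrt (T n))⁻¹ • G n x θ‖ ^ 2 := by
  rw [contrast, norm_smul, mul_pow, norm_inv, Real.norm_of_nonneg (Real.sqrt_nonneg _), inv_pow,
    Real.sq_sqrt (hT n).le]
  ring

lemma sqrt_smul_deviation (hT : ∀ n, 0 < T n) (n : ℕ) (y z : Vec p) :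
    Real.sqrt (T n) • ((T n)⁻¹ • y - z) = (Real.sqrt (T n))⁻¹ • y - Real.sqrt (T n) • z := by
  have hs : 0 < Real.sqrt (T n) := Real.sqrt_pos.2 (hT n)
  rw [smul_sub, smul_smul]
  congr 2
  nth_rewrite 2 [← Real.mul_self_sqrt (hT n).le]
  field_simp

/-- The identifiability condition, with the square root taken. -/
lemma exists_mul_norm_le {Ginf : Vec p → Vec p}
    (h : ∃ χ : ℝ, 0 < χ ∧ ∀ θ ∈ Θ, χ * ‖θ - θ₀‖ ^ 2 ≤ ‖Ginf θ‖ ^ 2) :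
    ∃ c : ℝ, 0 < c ∧ ∀ θ ∈ Θ, c * ‖θ - θ₀‖ ≤ ‖Ginf θ‖ := by
  obtain ⟨χ, hχ, h⟩ := h
  refine ⟨Real.sqrt χ, Real.sqrt_pos.2 hχ, fun θ hθ => ?_⟩
  refine abs_le_of_sq_le_sq' ?_ (norm_nonneg _) |>.2
  rw [mul_pow, Real.sq_sqrt hχ.le]
  exact h θ hθ

lemma norm_sub_le_toReal_maxDeviation (hT : ∀ n, 0 < T n) {Ginf : Vec p → Vec p} {n : ℕ} {x : X n}
    (hA : maxDeviation T G Ginf D n x ≠ ∞) {θ : Vec p} (hθ : θ ∈ D) :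
    ‖(Real.sqrt (T n))⁻¹ • G n x θ - Real.sqrt (T n) • Ginf θ‖ ≤
      (maxDeviation T G Ginf D n x).toReal := by
  rw [← sqrt_smul_deviation hT, ← toReal_enorm]
  exact ENNReal.toReal_mono hA
    (le_iSup₂ (f := fun θ (_ : θ ∈ D) => ‖Real.sqrt (T n) • ((T n)⁻¹ • G n x θ - Ginf θ)‖ₑ) θ hθ)

/-- The key lower bound: the rescaled estimating function grows at least linearly in the local
parameter, up to the maximal deviation. -/
lemma mul_norm_le_norm_add_maxDeviation (hT : ∀ n, 0 < T n) (hDΘ : D ⊆ Θ)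
    (hD : closure Θ ⊆ closure D) {Ginf : Vec p → Vec p} {c : ℝ}
    (hc : ∀ θ ∈ Θ, c * ‖θ - θ₀‖ ≤ ‖Ginf θ‖) {n : ℕ} {x : X n}
    (hcont : ContinuousOn (G n x) (closure Θ)) (hA : maxDeviation T G Ginf D n x ≠ ∞)
    {θ : Vec p} (hθ : θ ∈ closure Θ) :
    c * ‖Real.sqrt (T n) • (θ - θ₀)‖ ≤
      ‖(Real.sqrt (T n))⁻¹ • G n x θ‖ + (maxDeviation T G Ginf D n x).toReal := by
  refine le_on_closure_of_dense hDΘ hD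
    (f := fun θ => c * ‖Real.sqrt (T n) • (θ - θ₀)‖)
    (k := fun θ => ‖(Real.sqrt (T n))⁻¹ • G n x θ‖ + (maxDeviation T G Ginf D n x).toReal)
    (by fun_prop) (by fun_prop) (fun θ hθ => ?_) hθ
  have hs : 0 ≤ Real.sqrt (T n) := Real.sqrt_nonneg _
  have h1 := norm_sub_le_toReal_maxDeviation hT hA hθ
  have h2 := norm_le_norm_add_norm_sub ((Real.sqrt (T n))⁻¹ • G n x θ) (Real.sqrt (T n) • Ginf θ)
  rw [norm_smul _ (Ginf θ), Real.norm_of_nonneg hs] at h2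
  rw [norm_smul, Real.norm_of_nonneg hs]
  nlinarith [mul_le_mul_of_nonneg_left (hc θ (hDΘ hθ)) hs]

lemma norm_le_maxDeviation (hT : ∀ n, 0 < T n) {Ginf : Vec p → Vec p} (hzero : Ginf θ₀ = 0)
    (hθ₀ : θ₀ ∈ D) {n : ℕ} {x : X n} (hA : maxDeviation T G Ginf D n x ≠ ∞) :
    ‖(Real.sqrt (T n))⁻¹ • G n x θ₀‖ ≤ (maxDeviation T G Ginf D n x).toReal := by
  simpa [hzero] using norm_sub_le_toReal_maxDeviation hT hA hθ₀

/-- Away from the origin, the random field is small unless the maximal deviation is large. -/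
lemma randomField_le (hT : ∀ n, 0 < T n) (hDΘ : D ⊆ Θ)
    (hD : closure Θ ⊆ closure D) (hθ₀ : θ₀ ∈ D) {Ginf : Vec p → Vec p} (hzero : Ginf θ₀ = 0)
    {c : ℝ} (hc0 : 0 < c) (hc : ∀ θ ∈ Θ, c * ‖θ - θ₀‖ ≤ ‖Ginf θ‖) {n : ℕ} {x : X n}
    (hcont : ContinuousOn (G n x) (closure Θ)) {r : ℝ} (hr : 0 < r)
    (hA : maxDeviation T G Ginf D n x < ENNReal.ofReal (c / 4 * r)) {u : Vec p}
    (hu : u ∈ localSet Θ θ₀ T n) (hru : r < ‖u‖) :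
    randomField T G θ₀ n x u ≤ Real.exp (-(c ^ 2 / 2 * r ^ 2)) := by
  have hAtop : maxDeviation T G Ginf D n x ≠ ∞ := hA.ne_top
  have ha : (maxDeviation T G Ginf D n x).toReal < c / 4 * r :=
    (ENNReal.lt_ofReal_iff_toReal_lt hAtop).1 hA
  have hs : 0 < Real.sqrt (T n) := Real.sqrt_pos.2 (hT n)
  have h1 := mul_norm_le_norm_add_maxDeviation hT hDΘ hD hc hcont hAtop
    (subset_closure (show θ₀ + (Real.sqrt (T n))⁻¹ • u ∈ Θ from hu))
  have h2 := norm_le_maxDeviation hT hzero hθ₀ hAtop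
  rw [add_sub_cancel_left, smul_smul, mul_inv_cancel₀ hs.ne', one_smul] at h1
  rw [randomField, contrast_eq hT, contrast_eq hT, Real.exp_le_exp]
  set a := (maxDeviation T G Ginf D n x).toReal
  set g := ‖(Real.sqrt (T n))⁻¹ • G n x (θ₀ + (Real.sqrt (T n))⁻¹ • u)‖
  set g₀ := ‖(Real.sqrt (T n))⁻¹ • G n x θ₀‖
  have ha0 : 0 ≤ a := ENNReal.toReal_nonneg
  have hg₀ : g₀ ^ 2 ≤ a ^ 2 := pow_le_pow_left₀ (norm_nonneg _) h2 2
  have hcr : c * r < c * ‖u‖ := by gcongr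
  have hg : (c * ‖u‖ - a) ^ 2 ≤ g ^ 2 :=
    pow_le_pow_left₀ (by nlinarith) (by linarith) 2
  have hcr0 : 0 < c * r := by positivity
  have h3 : (c * r) ^ 2 ≤ (c * ‖u‖) ^ 2 := pow_le_pow_left₀ hcr0.le hcr.le 2
  nlinarith [mul_nonneg (hcr0.le.trans hcr.le) (show 0 ≤ c * ‖u‖ - 4 * a by linarith)]

end Deterministic

/-! ### The polynomial type large deviation inequality -/

section LargeDeviation

variable {p : ℕ} {X : ℕ → Type*} [∀ n, MeasurableSpace (X n)] {P : ∀ n, Measure (X n)}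
  {T : ℕ → ℝ} {G : ∀ n, X n → Vec p → Vec p} {Θ D : Set (Vec p)} {θ₀ : Vec p}

lemma iSup_lintegral_maxDeviation_lt_top [∀ n, IsProbabilityMeasure (P n)] (hDΘ : D ⊆ Θ) {M : ℝ}
    (hM : 0 < M) {Ginf : Vec p → Vec p} (h3a : LimitField P T G Θ θ₀ M Ginf) :
    ⨆ n, ∫⁻ x, maxDeviation T G Ginf D n x ^ M ∂(P n) < ∞ := by
  obtain ⟨ε, hε, h⟩ := h3a.moment
  refine iSup_lintegral_rpow_lt_top_of_le hM.le (by linarith : M ≤ M + ε)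
    (lt_of_le_of_lt (iSup_mono fun n => lintegral_mono fun x => ?_) h)
  exact ENNReal.rpow_le_rpow (biSup_mono fun θ hθ => hDΘ hθ) (by linarith)

theorem pldi_of_limitField [∀ n, IsProbabilityMeasure (P n)] (hopen : IsOpen Θ) (hθ₀ : θ₀ ∈ Θ)
    (hG : ∀ n, ∀ θ ∈ Θ, Measurable (fun x => G n x θ)) (hT : ∀ n, 0 < T n) {M : ℝ} (hM : 0 < M)
    (h1 : Smoothness P G Θ) {Ginf : Vec p → Vec p} (h3a : LimitField P T G Θ θ₀ M Ginf) :
    PLDI P T G Θ θ₀ M := by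
  obtain ⟨D, hDΘ, hDc, hθD, hD⟩ := exists_countable_subset_dense hopen hθ₀
  obtain ⟨c, hc0, hc⟩ := exists_mul_norm_le h3a.identifiable
  set C := ⨆ n, ∫⁻ x, maxDeviation T G Ginf D n x ^ M ∂(P n) with hC
  have hCtop : C < ∞ := iSup_lintegral_maxDeviation_lt_top hDΘ hM h3a
  refine lt_of_le_of_lt (b := ENNReal.ofReal ((2 / c ^ 2) ^ M) +
    C * ENNReal.ofReal ((c / 4) ^ (-M))) (iSup_le ?_)
    (ENNReal.add_lt_top.2 ⟨ENNReal.ofReal_lt_top, ENNReal.mul_lt_top hCtop ENNReal.ofReal_lt_top⟩)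
  rintro ⟨r, hr : 0 < r⟩
  simp only
  -- for `r ≤ 2 / c²` probabilities are bounded by one, for larger `r` one has `r < c² r² / 2`
  rcases le_or_gt r (2 / c ^ 2) with hrc | hrc
  · refine le_trans ?_ le_self_add
    calc _ ≤ ENNReal.ofReal (r ^ M) * 1 := by
            gcongr
            exact iSup_le fun n => prob_le_one
      _ ≤ _ := by
            rw [mul_one]
            gcongr
  · refine le_trans ?_ le_add_self
    have hexp : Real.exp (-(c ^ 2 / 2 * r ^ 2)) < Real.exp (-r) := by
      rw [Real.exp_lt_exp]
      rw [div_lt_iff₀ (by positivity)] at hrc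
      nlinarith
    have hsup : ⨆ n, P n {x | ENNReal.ofReal (Real.exp (-r)) ≤
        ⨆ u ∈ {u | u ∈ localSet Θ θ₀ T n ∧ r < ‖u‖},
          ENNReal.ofReal (randomField T G θ₀ n x u)} ≤
        ⨆ n, P n {x | ENNReal.ofReal (c / 4 * r) ≤ maxDeviation T G Ginf D n x} := by
      refine iSup_mono fun n => measure_mono_ae ?_
      filter_upwards [h1 n] with x hx hxr
      by_contra hcon
      have hA : maxDeviation T G Ginf D n x < ENNReal.ofReal (c / 4 * r) := not_le.1 hcon
      refine absurd (hxr.trans (iSup₂_le fun u hu => ENNReal.ofReal_le_ofReal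
        (randomField_le hT hDΘ hD hθD h3a.zero hc0 hc hx.1 hr hA hu.1 hu.2))) ?_
      rw [not_le]
      exact (ENNReal.ofReal_lt_ofReal_iff (Real.exp_pos _)).2 hexp
    calc _ ≤ ENNReal.ofReal (r ^ M) * (C * ENNReal.ofReal ((c / 4 * r) ^ (-M))) := by
            gcongr
            exact hsup.trans (iSup_measure_le_of_iSup_lintegral_rpow
              (fun n => (measurable_maxDeviation hG hDΘ hDc Ginf n).aemeasurable) hM
              (by positivity))
      _ = _ := by
            rw [mul_left_comm, ← ENNReal.ofReal_mul (by positivity),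
              Real.mul_rpow (by positivity) hr.le, mul_left_comm, ← Real.rpow_add hr]
            simp

end LargeDeviation

/-! ### Asymptotic linearity of the estimator -/

section Linearity

variable {p : ℕ} {X : ℕ → Type*} {T : ℕ → ℝ} {G : ∀ n, X n → Vec p → Vec p}
  {Θ D : Set (Vec p)} {θ₀ : Vec p}

/-- When the Taylor remainder and the deviation of the Jacobian are at most `R`, the rescaled
estimating function is affine in the local parameter up to an error of order `T_n^{-1/2}`. -/
lemma norm_sub_linearization_le (hT : ∀ n, 0 < T n) (hDΘ : D ⊆ Θ) (hD : closure Θ ⊆ closure D)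
    {G' : Matrix (Fin p) (Fin p) ℝ} {n : ℕ} {x : X n} (hcont : ContinuousOn (G n x) (closure Θ))
    {R : ℝ} (hR : 0 ≤ R) (hB : taylorRemainder T G θ₀ D n x ≤ ENNReal.ofReal R)
    (hJ : jacobianDeviation T G θ₀ G' n x ≤ ENNReal.ofReal R) {θ : Vec p} (hθ : θ ∈ closure Θ) :
    ‖(Real.sqrt (T n))⁻¹ • G n x θ - (Real.sqrt (T n))⁻¹ • G n x θ₀ -
        Matrix.toEuclideanCLM (𝕜 := ℝ) G' (Real.sqrt (T n) • (θ - θ₀))‖ ≤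
      R / Real.sqrt (T n) * (‖Real.sqrt (T n) • (θ - θ₀)‖ ^ 2 +
        ‖Real.sqrt (T n) • (θ - θ₀)‖) := by
  refine le_on_closure_of_dense hDΘ hD
    (f := fun θ => ‖(Real.sqrt (T n))⁻¹ • G n x θ - (Real.sqrt (T n))⁻¹ • G n x θ₀ -
        Matrix.toEuclideanCLM (𝕜 := ℝ) G' (Real.sqrt (T n) • (θ - θ₀))‖)
    (k := fun θ => R / Real.sqrt (T n) * (‖Real.sqrt (T n) • (θ - θ₀)‖ ^ 2 +
        ‖Real.sqrt (T n) • (θ - θ₀)‖))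
    (by fun_prop) (by fun_prop) (fun θ hθ => ?_) hθ
  set s := Real.sqrt (T n) with hsdef
  have hs : 0 < s := Real.sqrt_pos.2 (hT n)
  have hsT : T n = s * s := (Real.mul_self_sqrt (hT n).le).symm
  set F := fderiv ℝ (G n x) θ₀
  set h := θ - θ₀
  have hB' : ‖G n x θ - G n x θ₀ - F h‖ ≤ R * (T n * ‖h‖ ^ 2) := by
    have hle := (le_iSup₂ (f := fun θ (_ : θ ∈ D) => ‖(T n * ‖θ - θ₀‖ ^ 2)⁻¹ •
      (G n x θ - G n x θ₀ - fderiv ℝ (G n x) θ₀ (θ - θ₀))‖ₑ) θ hθ).trans hB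
    rcases eq_or_ne θ θ₀ with rfl | hne
    · simp [h]
    have hpos : 0 < ‖h‖ := norm_pos_iff.2 (sub_ne_zero.2 hne)
    have hTh : 0 < T n * ‖h‖ ^ 2 := mul_pos (hT n) (by positivity)
    rw [← ofReal_norm, ENNReal.ofReal_le_ofReal_iff hR, norm_smul, norm_inv,
      Real.norm_of_nonneg hTh.le, inv_mul_le_iff₀ hTh] at hle
    linarith
  have hJ' : ‖s • ((T n)⁻¹ • F - Matrix.toEuclideanCLM (𝕜 := ℝ) G')‖ ≤ R := by
    rwa [jacobianDeviation, ← ofReal_norm, ENNReal.ofReal_le_ofReal_iff hR] at hJ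
  have hdecomp : s⁻¹ • G n x θ - s⁻¹ • G n x θ₀ - Matrix.toEuclideanCLM (𝕜 := ℝ) G' (s • h) =
      s⁻¹ • (G n x θ - G n x θ₀ - F h) +
        (s • ((T n)⁻¹ • F - Matrix.toEuclideanCLM (𝕜 := ℝ) G')) h := by
    have hsT' : s * (T n)⁻¹ = s⁻¹ := by rw [hsT]; field_simp
    simp only [smul_sub, smul_smul, hsT', sub_apply,
      smul_apply, map_smul]
    abel
  rw [hdecomp]
  calc _ ≤ ‖s⁻¹ • (G n x θ - G n x θ₀ - F h)‖ +
        ‖(s • ((T n)⁻¹ • F - Matrix.toEuclideanCLM (𝕜 := ℝ) G')) h‖ := norm_add_le _ _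
    _ ≤ s⁻¹ * (R * (T n * ‖h‖ ^ 2)) + R * ‖h‖ := by
        gcongr
        · rw [norm_smul, norm_inv, Real.norm_of_nonneg hs.le]
          gcongr
        · exact ContinuousLinearMap.le_of_opNorm_le _ hJ' h
    _ = R / s * (‖s • h‖ ^ 2 + ‖s • h‖) := by
        rw [norm_smul, Real.norm_of_nonneg hs.le, hsT]
        field_simp

/-- The size of the local parameters of the estimator is controlled by the maximal deviation. -/
lemma enorm_normalized_le (hT : ∀ n, 0 < T n) (hDΘ : D ⊆ Θ)
    (hD : closure Θ ⊆ closure D) (hθ₀ : θ₀ ∈ D) {Ginf : Vec p → Vec p} (hzero : Ginf θ₀ = 0)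
    {c : ℝ} (hc0 : 0 < c) (hc : ∀ θ ∈ Θ, c * ‖θ - θ₀‖ ≤ ‖Ginf θ‖) {n : ℕ} {x : X n}
    (hcont : ContinuousOn (G n x) (closure Θ)) {θhat : ∀ n, X n → Vec p}
    (hmem : θhat n x ∈ closure Θ)
    (hmax : ∀ θ ∈ closure Θ, contrast T G n x θ ≤ contrast T G n x (θhat n x)) :
    ‖normalized T θ₀ θhat n x‖ₑ ≤ ENNReal.ofReal (2 / c) * maxDeviation T G Ginf D n x := by
  rcases eq_or_ne (maxDeviation T G Ginf D n x) ∞ with hA | hA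
  · rw [hA, ENNReal.mul_top (by simpa using hc0)]
    exact le_top
  have h1 := mul_norm_le_norm_add_maxDeviation hT hDΘ hD hc hcont hA hmem
  have h2 := norm_le_maxDeviation hT hzero hθ₀ hA
  have h3 := hmax θ₀ (subset_closure (hDΘ hθ₀))
  rw [contrast_eq hT, contrast_eq hT, neg_le_neg_iff] at h3
  have h4 := (pow_le_pow_iff_left₀ (norm_nonneg _) (norm_nonneg _) two_ne_zero).1 h3
  rw [← ENNReal.ofReal_toReal hA, ← ENNReal.ofReal_mul (by positivity), ← ofReal_norm]
  refine ENNReal.ofReal_le_ofReal ?_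
  rw [normalized, div_mul_eq_mul_div, le_div_iff₀ hc0]
  linarith

/-- The estimator differs from the root of the linearized estimating equation by `O(T_n^{-1/2})`
on the event where all majorants are at most `R`. The estimator beats the parameter
`θ₀ - T_n^{-1/2} (G')⁻¹ T_n^{-1/2} G_n(θ₀)`, at which the linearization vanishes. -/
lemma norm_normalized_add_le (hT : ∀ n, 0 < T n) (hDΘ : D ⊆ Θ)
    (hD : closure Θ ⊆ closure D) (hθ₀ : θ₀ ∈ D) {Ginf : Vec p → Vec p} (hzero : Ginf θ₀ = 0)
    {c : ℝ} (hc0 : 0 < c) (hc : ∀ θ ∈ Θ, c * ‖θ - θ₀‖ ≤ ‖Ginf θ‖)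
    {G' : Matrix (Fin p) (Fin p) ℝ} (hG' : IsUnit G'.det) {ρ : ℝ}
    (hball : Metric.ball θ₀ ρ ⊆ Θ) {n : ℕ} {x : X n}
    (hcont : ContinuousOn (G n x) (closure Θ)) {θhat : ∀ n, X n → Vec p}
    (hmem : θhat n x ∈ closure Θ)
    (hmax : ∀ θ ∈ closure Θ, contrast T G n x θ ≤ contrast T G n x (θhat n x))
    {R : ℝ} (hR : 0 ≤ R) (hA : maxDeviation T G Ginf D n x ≤ ENNReal.ofReal R)
    (hB : taylorRemainder T G θ₀ D n x ≤ ENNReal.ofReal R)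
    (hJ : jacobianDeviation T G θ₀ G' n x ≤ ENNReal.ofReal R)
    (hρ : ‖Matrix.toEuclideanCLM (𝕜 := ℝ) G'⁻¹‖ * R / Real.sqrt (T n) < ρ) :
    ‖normalized T θ₀ θhat n x -
        -(Matrix.toEuclideanCLM (𝕜 := ℝ) G'⁻¹ ((Real.sqrt (T n))⁻¹ • G n x θ₀))‖ ≤
      ‖Matrix.toEuclideanCLM (𝕜 := ℝ) G'⁻¹‖ * (R * ((2 / c * R) ^ 2 + 2 / c * R +
        ((‖Matrix.toEuclideanCLM (𝕜 := ℝ) G'⁻¹‖ * R) ^ 2 +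
          ‖Matrix.toEuclideanCLM (𝕜 := ℝ) G'⁻¹‖ * R))) / Real.sqrt (T n) := by
  have hs : 0 < Real.sqrt (T n) := Real.sqrt_pos.2 (hT n)
  have hlin {θ : Vec p} (hθ : θ ∈ closure Θ) :=
    norm_sub_linearization_le hT hDΘ hD hcont hR hB hJ hθ
  have hinv : ∀ y,
      Matrix.toEuclideanCLM (𝕜 := ℝ) G'⁻¹ (Matrix.toEuclideanCLM (𝕜 := ℝ) G' y) = y :=
    fun y => by
      rw [← mul_apply_eq_comp, ← map_mul, Matrix.nonsing_inv_mul _ hG', map_one]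
      rfl
  have hinv' : ∀ y,
      Matrix.toEuclideanCLM (𝕜 := ℝ) G' (Matrix.toEuclideanCLM (𝕜 := ℝ) G'⁻¹ y) = y :=
    fun y => by
      rw [← mul_apply_eq_comp, ← map_mul, Matrix.mul_nonsing_inv _ hG', map_one]
      rfl
  set s := Real.sqrt (T n)
  set L := Matrix.toEuclideanCLM (𝕜 := ℝ) G'
  set L' := Matrix.toEuclideanCLM (𝕜 := ℝ) G'⁻¹
  set g₀ := s⁻¹ • G n x θ₀
  have hAtop : maxDeviation T G Ginf D n x ≠ ∞ := ne_top_of_le_ne_top ENNReal.ofReal_ne_top hA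
  have hg₀ : ‖g₀‖ ≤ R := (norm_le_maxDeviation hT hzero hθ₀ hAtop).trans
    (ENNReal.toReal_le_of_le_ofReal hR hA)
  have hu : ‖normalized T θ₀ θhat n x‖ ≤ 2 / c * R := by
    have h := (enorm_normalized_le hT hDΘ hD hθ₀ hzero hc0 hc hcont hmem hmax).trans
      (mul_le_mul_right hA _)
    rwa [← ENNReal.ofReal_mul (by positivity), ← ofReal_norm,
      ENNReal.ofReal_le_ofReal_iff (by positivity)] at h
  have hv : ‖L' g₀‖ ≤ ‖L'‖ * R := L'.le_opNorm_of_le hg₀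
  have hstar : θ₀ + s⁻¹ • -(L' g₀) ∈ closure Θ := by
    refine subset_closure (hball ?_)
    rw [mem_ball_iff_norm, add_sub_cancel_left, norm_smul, norm_inv, norm_neg,
      Real.norm_of_nonneg hs.le, inv_mul_eq_div]
    exact lt_of_le_of_lt (by gcongr) hρ
  have hstar_le := hlin hstar
  rw [add_sub_cancel_left, smul_smul, mul_inv_cancel₀ hs.ne', one_smul, map_neg, hinv',
    sub_neg_eq_add, sub_add_cancel, norm_neg] at hstar_le
  have hhat := hlin hmem
  have hcmp := hmax _ hstar
  rw [contrast_eq hT, contrast_eq hT, neg_le_neg_iff] at hcmp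
  have hcmp := (pow_le_pow_iff_left₀ (norm_nonneg _) (norm_nonneg _) two_ne_zero).1 hcmp
  change ‖s⁻¹ • G n x (θhat n x) - g₀ - L (normalized T θ₀ θhat n x)‖ ≤
    R / s * (‖normalized T θ₀ θhat n x‖ ^ 2 + ‖normalized T θ₀ θhat n x‖) at hhat
  set u := normalized T θ₀ θhat n x
  have hLu : ‖L u + g₀‖ ≤ R / s * ((2 / c * R) ^ 2 + 2 / c * R +
      ((‖L'‖ * R) ^ 2 + ‖L'‖ * R)) := by
    calc ‖L u + g₀‖ = ‖s⁻¹ • G n x (θhat n x) - (s⁻¹ • G n x (θhat n x) - g₀ - L u)‖ := by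
          congr 1; abel
      _ ≤ ‖s⁻¹ • G n x (θhat n x)‖ + ‖s⁻¹ • G n x (θhat n x) - g₀ - L u‖ := norm_sub_le _ _
      _ ≤ R / s * (‖L' g₀‖ ^ 2 + ‖L' g₀‖) + R / s * (‖u‖ ^ 2 + ‖u‖) :=
          add_le_add (hcmp.trans hstar_le) hhat
      _ ≤ R / s * ((‖L'‖ * R) ^ 2 + ‖L'‖ * R) + R / s * ((2 / c * R) ^ 2 + 2 / c * R) := by
          gcongr
      _ = _ := by ring
  calc ‖u - -(L' g₀)‖ = ‖L' (L u + g₀)‖ := by rw [map_add, hinv, sub_neg_eq_add]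
    _ ≤ ‖L'‖ * (R / s * ((2 / c * R) ^ 2 + 2 / c * R + ((‖L'‖ * R) ^ 2 + ‖L'‖ * R))) :=
        L'.le_opNorm_of_le hLu
    _ = _ := by ring

lemma isUnit_det_of_rank_eq {G' : Matrix (Fin p) (Fin p) ℝ} (h : G'.rank = p) :
    IsUnit G'.det := by
  rw [← Matrix.isUnit_iff_isUnit_det, ← Matrix.mulVec_surjective_iff_isUnit]
  have htop : LinearMap.range G'.mulVecLin = ⊤ :=
    Submodule.eq_top_of_finrank_eq (by rw [← Matrix.rank, h]; simp)
  exact LinearMap.range_eq_top.1 htop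

variable [∀ n, MeasurableSpace (X n)] {P : ∀ n, Measure (X n)}

/-- The estimator is asymptotically linear: `û_n + (G')⁻¹ T_n^{-1/2} G_n(θ₀)` tends to `0` in
probability. -/
lemma tendsto_measure_normalized_sub [∀ n, IsProbabilityMeasure (P n)] (hopen : IsOpen Θ)
    (hconvex : Convex ℝ Θ) (hθ₀ : θ₀ ∈ Θ) (hG : ∀ n, ∀ θ ∈ Θ, Measurable (fun x => G n x θ))
    (hT : ∀ n, 0 < T n) (hTlim : Tendsto T atTop atTop) {M : ℝ} (hM : 0 < M)
    (h1 : Smoothness P G Θ) (h2 : BoundedMoments P T G Θ θ₀) {Ginf : Vec p → Vec p}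
    (h3a : LimitField P T G Θ θ₀ M Ginf) {G' : Matrix (Fin p) (Fin p) ℝ}
    (h3b : LimitJacobian P T G θ₀ M G') {θhat : ∀ n, X n → Vec p}
    (hθhat : IsMEstimator P T G Θ θhat) {δ : ℝ} (hδ : 0 < δ) :
    Tendsto (fun n => P n {x | δ ≤ ‖normalized T θ₀ θhat n x -
      -(Matrix.toEuclideanCLM (𝕜 := ℝ) G'⁻¹ ((Real.sqrt (T n))⁻¹ • G n x θ₀))‖})
      atTop (𝓝 0) := by
  obtain ⟨D, hDΘ, hDc, hθD, hD⟩ := exists_countable_subset_dense hopen hθ₀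
  obtain ⟨c, hc0, hc⟩ := exists_mul_norm_le h3a.identifiable
  obtain ⟨ρ, hρ0, hball⟩ := Metric.isOpen_iff.1 hopen θ₀ hθ₀
  have hunit := isUnit_det_of_rank_eq h3b.rank
  have hsqrt : Tendsto (fun n => Real.sqrt (T n)) atTop atTop :=
    Real.tendsto_sqrt_atTop.comp hTlim
  have htailA := tendsto_iSup_measure_of_iSup_lintegral_rpow
    (fun n => (measurable_maxDeviation (T := T) hG hDΘ hDc Ginf n).aemeasurable) hM
    (iSup_lintegral_maxDeviation_lt_top hDΘ hM h3a)
  have htailJ := tendsto_iSup_measure_of_iSup_lintegral_rpow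
    (fun n => aemeasurable_jacobianDeviation (T := T) hopen hθ₀ hG h1 G' n) hM h3b.moment
  have htailB := tendsto_iSup_measure_of_iSup_lintegral_rpow
    (fun n => aemeasurable_taylorRemainder (T := T) hopen hθ₀ hG h1 hDΘ hDc n) one_pos (by
      refine lt_of_le_of_lt (iSup_mono fun n => lintegral_mono_ae ?_)
        ((le_iSup _ (2 : Fin 4)).trans_lt (ENNReal.add_lt_top.1 (h2 1 one_pos)).2)
      filter_upwards [h1 n] with x hx
      exact ENNReal.rpow_le_rpow (taylorRemainder_le hT hopen hconvex hθ₀ hDΘ hx.2) zero_le_one)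
  have htail := (htailA.add htailJ).add htailB
  simp only [add_zero] at htail
  rw [ENNReal.tendsto_nhds_zero]
  intro ε hε
  -- fix a level `R` that the three majorants exceed with probability at most `ε`, for every `n`
  obtain ⟨R, hRε, hR⟩ := ((ENNReal.tendsto_nhds_zero.1 htail ε hε).and
    (eventually_ge_atTop 0)).exists
  have hlim1 := Tendsto.const_div_atTop hsqrt (‖Matrix.toEuclideanCLM (𝕜 := ℝ) G'⁻¹‖ * R)
  have hlim2 := Tendsto.const_div_atTop hsqrt (‖Matrix.toEuclideanCLM (𝕜 := ℝ) G'⁻¹‖ *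
    (R * ((2 / c * R) ^ 2 + 2 / c * R + ((‖Matrix.toEuclideanCLM (𝕜 := ℝ) G'⁻¹‖ * R) ^ 2 +
      ‖Matrix.toEuclideanCLM (𝕜 := ℝ) G'⁻¹‖ * R))))
  filter_upwards [hlim1.eventually_lt_const hρ0, hlim2.eventually_lt_const hδ] with n hn1 hn2
  refine le_trans ?_ ((add_le_add (add_le_add (le_iSup _ n) (le_iSup _ n)) (le_iSup _ n)).trans hRε)
  refine le_trans (measure_mono_ae ?_) ((measure_union_le _ _).trans
    (add_le_add (measure_union_le _ _) le_rfl))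
  filter_upwards [h1 n, hθhat.argmax n] with x hx hx' hxδ
  by_contra hcon
  change ¬ ((_ ∨ _) ∨ _) at hcon
  simp only [not_or] at hcon
  obtain ⟨⟨hA, hJ⟩, hB⟩ := hcon
  exact absurd ((norm_normalized_add_le hT hDΘ hD hθD h3a.zero hc0 hc hunit hball hx.1 hx'.1
    hx'.2 hR (not_le.1 hA).le (not_le.1 hB).le (not_le.1 hJ).le hn1).trans_lt hn2)
    (not_lt.2 hxδ)

end Linearity

/-! ### Convergence of moments -/

section Moments

variable {p : ℕ} {X : ℕ → Type*} [∀ n, MeasurableSpace (X n)] {P : ∀ n, Measure (X n)}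
  [∀ n, IsProbabilityMeasure (P n)] {T : ℕ → ℝ} {G : ∀ n, X n → Vec p → Vec p}
  {Θ : Set (Vec p)} {θ₀ : Vec p}

lemma iSup_lintegral_normalized_lt_top (hopen : IsOpen Θ) (hθ₀ : θ₀ ∈ Θ)
    (hT : ∀ n, 0 < T n) {M : ℝ} (hM : 0 < M) (h1 : Smoothness P G Θ) {Ginf : Vec p → Vec p}
    (h3a : LimitField P T G Θ θ₀ M Ginf) {θhat : ∀ n, X n → Vec p}
    (hθhat : IsMEstimator P T G Θ θhat) :
    ⨆ n, ∫⁻ x, ‖normalized T θ₀ θhat n x‖ₑ ^ M ∂(P n) < ∞ := by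
  obtain ⟨D, hDΘ, -, hθD, hD⟩ := exists_countable_subset_dense hopen hθ₀
  obtain ⟨c, hc0, hc⟩ := exists_mul_norm_le h3a.identifiable
  have hA := iSup_lintegral_maxDeviation_lt_top hDΘ hM h3a
  have hconst : ENNReal.ofReal (2 / c) ^ M ≠ ∞ :=
    ENNReal.rpow_ne_top_of_nonneg hM.le ENNReal.ofReal_ne_top
  refine lt_of_le_of_lt (iSup_le fun n => ?_) (ENNReal.mul_lt_top hconst.lt_top hA)
  calc ∫⁻ x, ‖normalized T θ₀ θhat n x‖ₑ ^ M ∂(P n)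
      ≤ ∫⁻ x, ENNReal.ofReal (2 / c) ^ M * maxDeviation T G Ginf D n x ^ M ∂(P n) := by
        refine lintegral_mono_ae ?_
        filter_upwards [h1 n, hθhat.argmax n] with x hx hx'
        rw [← ENNReal.mul_rpow_of_nonneg _ _ hM.le]
        exact ENNReal.rpow_le_rpow
          (enorm_normalized_le hT hDΘ hD hθD h3a.zero hc0 hc hx.1 hx'.1 hx'.2) hM.le
    _ = ENNReal.ofReal (2 / c) ^ M * ∫⁻ x, maxDeviation T G Ginf D n x ^ M ∂(P n) :=
        lintegral_const_mul' _ _ hconst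
    _ ≤ _ := by
        gcongr
        exact le_iSup (fun n => ∫⁻ x, maxDeviation T G Ginf D n x ^ M ∂(P n)) n

/-- If `Y_n` has bounded moments of order `M` and `f` grows with order `q`, then `f(Y_n)` has bounded
moments of order `M / q`. -/
lemma iSup_lintegral_comp_lt_top {Y : ∀ n, X n → Vec p} {f : Vec p → ℝ} {C q M : ℝ}
    (hC : 0 ≤ C) (hf : ∀ u, |f u| ≤ C * max 1 ‖u‖ ^ q) (hq : 0 < q) (hM : 0 < M)
    (hY : ⨆ n, ∫⁻ x, ‖Y n x‖ₑ ^ M ∂(P n) < ∞) :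
    ⨆ n, ∫⁻ x, ‖f (Y n x)‖ₑ ^ (M / q) ∂(P n) < ∞ := by
  have hs : 0 ≤ M / q := by positivity
  have hpt : ∀ u, ‖f u‖ₑ ^ (M / q) ≤ ENNReal.ofReal (C ^ (M / q)) * (1 + ‖u‖ₑ ^ M) := by
    intro u
    have hreal : |f u| ^ (M / q) ≤ C ^ (M / q) * (1 + ‖u‖ ^ M) := by
      calc |f u| ^ (M / q) ≤ (C * max 1 ‖u‖ ^ q) ^ (M / q) :=
            Real.rpow_le_rpow (abs_nonneg _) (hf u) hs
        _ = C ^ (M / q) * max 1 ‖u‖ ^ M := by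
            rw [Real.mul_rpow hC (by positivity), ← Real.rpow_mul (by positivity),
              mul_div_cancel₀ _ hq.ne']
        _ ≤ C ^ (M / q) * (1 + ‖u‖ ^ M) := by
            gcongr
            have : (0 : ℝ) ≤ ‖u‖ ^ M := by positivity
            rcases max_cases 1 ‖u‖ with h | h <;> rw [h.1]
            · simpa using this
            · linarith
    have h := ENNReal.ofReal_le_ofReal hreal
    rwa [← ENNReal.ofReal_rpow_of_nonneg (abs_nonneg _) hs, ENNReal.ofReal_mul (by positivity),
      ENNReal.ofReal_add zero_le_one (by positivity), ENNReal.ofReal_one,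
      ← ENNReal.ofReal_rpow_of_nonneg (norm_nonneg _) hM.le, ofReal_norm,
      ← Real.enorm_eq_ofReal_abs] at h
  refine lt_of_le_of_lt (b := ENNReal.ofReal (C ^ (M / q)) *
    (1 + ⨆ n, ∫⁻ x, ‖Y n x‖ₑ ^ M ∂(P n))) (iSup_le fun n => ?_)
    (ENNReal.mul_lt_top ENNReal.ofReal_lt_top (ENNReal.add_lt_top.2 ⟨ENNReal.one_lt_top, hY⟩))
  calc ∫⁻ x, ‖f (Y n x)‖ₑ ^ (M / q) ∂(P n)
      ≤ ∫⁻ x, ENNReal.ofReal (C ^ (M / q)) * (1 + ‖Y n x‖ₑ ^ M) ∂(P n) :=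
        lintegral_mono fun x => hpt _
    _ = ENNReal.ofReal (C ^ (M / q)) * (1 + ∫⁻ x, ‖Y n x‖ₑ ^ M ∂(P n)) := by
        rw [lintegral_const_mul' _ _ ENNReal.ofReal_ne_top, lintegral_add_left measurable_const]
        simp
    _ ≤ _ := by
        gcongr
        exact le_iSup (fun n => ∫⁻ x, ‖Y n x‖ₑ ^ M ∂(P n)) n

/-- Functions of polynomial growth are integrable with respect to Gaussian measures. -/
lemma integrable_multivariateGaussian_of_growth {f : Vec p → ℝ} (hcont : Continuous f) {C q : ℝ}
    (hC : 0 ≤ C) (hf : ∀ u, |f u| ≤ C * max 1 ‖u‖ ^ q) (hq : 0 < q)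
    (m : Vec p) (V : Matrix (Fin p) (Fin p) ℝ) : Integrable f (multivariateGaussian m V) := by
  refine (((integrable_const (1 : ℝ)).add
    (integrable_norm_rpow_multivariateGaussian m V hq)).const_mul C).mono'
    hcont.aestronglyMeasurable (Eventually.of_forall fun u => (hf u).trans ?_)
  simp only [Pi.add_apply]
  gcongr
  have : (0 : ℝ) ≤ ‖u‖ ^ q := by positivity
  rcases max_cases 1 ‖u‖ with h | h <;> rw [h.1]
  · simpa using this
  · linarith

/-- The normalized estimator is asymptotically normal. The limit is represented as the image of
the Gaussian limit of the score under `-(G')⁻¹`. -/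
lemma tendstoInDistribution_normalized (hopen : IsOpen Θ)
    (hconvex : Convex ℝ Θ) (hθ₀ : θ₀ ∈ Θ) (hG : ∀ n, ∀ θ ∈ Θ, Measurable (fun x => G n x θ))
    (hT : ∀ n, 0 < T n) (hTlim : Tendsto T atTop atTop) {M : ℝ} (hM : 0 < M)
    (h1 : Smoothness P G Θ) (h2 : BoundedMoments P T G Θ θ₀) {Ginf : Vec p → Vec p}
    (h3a : LimitField P T G Θ θ₀ M Ginf) {G' : Matrix (Fin p) (Fin p) ℝ}
    (h3b : LimitJacobian P T G θ₀ M G') {V : Matrix (Fin p) (Fin p) ℝ}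
    (h4 : WeakConvergence P T G θ₀ V) {θhat : ∀ n, X n → Vec p}
    (hθhat : IsMEstimator P T G Θ θhat) :
    TendstoInDistribution (normalized T θ₀ θhat) atTop
      (Matrix.toEuclideanCLM (𝕜 := ℝ) (-G'⁻¹)) P (multivariateGaussian 0 V) := by
  refine tendstoInDistribution_of_tendsto_measure_sub
    (h4.2.continuous_comp (Matrix.toEuclideanCLM (𝕜 := ℝ) (-G'⁻¹)).continuous)
    (fun n => (((hθhat.measurable n).sub_const θ₀).const_smul (Real.sqrt (T n))).aemeasurable)
    fun δ hδ => ?_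
  simpa only [Function.comp_apply, map_neg, neg_apply] using
    tendsto_measure_normalized_sub hopen hconvex hθ₀ hG hT hTlim hM h1 h2 h3a h3b hθhat hδ

end Moments

end EstimatingFunction

theorem mainTheorem2 {p : ℕ} {X : ℕ → Type*} [∀ n, MeasurableSpace (X n)]
    (Θ : Set (EstimatingFunction.Vec p)) (hopen : IsOpen Θ) (hconvex : Convex ℝ Θ)
    (hbounded : Bornology.IsBounded Θ)
    (P : ∀ n, Θ → Measure (X n)) [∀ n θ, IsProbabilityMeasure (P n θ)] (θ₀ : Θ)
    (G : ∀ n, X n → EstimatingFunction.Vec p → EstimatingFunction.Vec p)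
    (hG : ∀ n, ∀ θ ∈ Θ, Measurable (fun x => G n x θ))
    (T : ℕ → ℝ) (hTpos : ∀ n, 0 < T n) (hT : Tendsto T atTop atTop)
    (M : ℝ) (hM : 0 < M)
    (h1 : EstimatingFunction.Smoothness (fun n => P n θ₀) G Θ)
    (h2 : EstimatingFunction.BoundedMoments (fun n => P n θ₀) T G Θ θ₀)
    (Ginf : EstimatingFunction.Vec p → EstimatingFunction.Vec p)
    (h3a : EstimatingFunction.LimitField (fun n => P n θ₀) T G Θ θ₀ M Ginf)
    (G' : Matrix (Fin p) (Fin p) ℝ)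
    (h3b : EstimatingFunction.LimitJacobian (fun n => P n θ₀) T G θ₀ M G') :
    EstimatingFunction.PLDI (fun n => P n θ₀) T G Θ θ₀ M ∧
    ∀ V : Matrix (Fin p) (Fin p) ℝ,
      EstimatingFunction.WeakConvergence (fun n => P n θ₀) T G θ₀ V →
      ∀ θhat : ∀ n, X n → EstimatingFunction.Vec p,
        EstimatingFunction.IsMEstimator (fun n => P n θ₀) T G Θ θhat →
        ∀ f : EstimatingFunction.Vec p → ℝ, Continuous f →
          ∀ q : ℝ, 0 < q → q < M →
            limsup (fun u => ENNReal.ofReal (‖u‖ ^ (-q) * |f u|))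
              (Bornology.cobounded (EstimatingFunction.Vec p)) < ∞ →
            (∀ n, Integrable
              (fun x => f (EstimatingFunction.normalized T θ₀ θhat n x)) (P n θ₀)) ∧
            Integrable f (multivariateGaussian 0 (EstimatingFunction.asympCov G' V)) ∧
            Tendsto
              (fun n => ∫ x, f (EstimatingFunction.normalized T θ₀ θhat n x) ∂(P n θ₀)) atTop
              (𝓝 (∫ u, f u ∂(multivariateGaussian 0 (EstimatingFunction.asympCov G' V)))) := by
  refine ⟨EstimatingFunction.pldi_of_limitField hopen θ₀.2 hG hTpos hM h1 h3a, ?_⟩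
  intro V h4 θhat hθhat f hf q hq hqM hgrowth
  obtain ⟨C, hC, hfC⟩ :=
    EstimatingFunction.exists_abs_le_max_one_norm_rpow hf hgrowth hq
  have hdist := EstimatingFunction.tendstoInDistribution_normalized hopen hconvex θ₀.2 hG hTpos hT
    hM h1 h2 h3a h3b h4 hθhat
  have hmom := EstimatingFunction.iSup_lintegral_comp_lt_top hC hfC hq hM
    (EstimatingFunction.iSup_lintegral_normalized_lt_top hopen θ₀.2 hTpos hM h1 h3a hθhat)
  have hmap : (multivariateGaussian 0 V).map (Matrix.toEuclideanCLM (𝕜 := ℝ) (-G'⁻¹)) =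
      multivariateGaussian 0 (EstimatingFunction.asympCov G' V) := by
    rw [EstimatingFunction.map_multivariateGaussian_zero _ h4.1.posSemidef,
      EstimatingFunction.asympCov]
    simp
  have hint := EstimatingFunction.integrable_multivariateGaussian_of_growth hf hC hfC hq 0
    (EstimatingFunction.asympCov G' V)
  have hint' := hint
  rw [← hmap, integrable_map_measure hf.aestronglyMeasurable (by fun_prop)] at hint'
  obtain ⟨hn, hlim⟩ := EstimatingFunction.tendsto_integral_of_tendstoInDistribution
    (hdist.continuous_comp hf) hint' ((one_lt_div hq).2 hqM) hmom
  refine ⟨hn, hint, ?_⟩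
  rw [← hmap, integral_map (by fun_prop) hf.aestronglyMeasurable]
  exact hlim
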